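/- Let $n\ge 1$. A cloud is a finite set $C\subset\mathbb{R}^n$; $|p-q|$ is Euclidean distance; $L_\infty$ is the maximum absolute difference of corresponding entries. **Strength.** For $n+1$ points $A=\{p_0,\dots,p_n\}\subset\mathbb{R}^n$, let $V(A)$ be the volume of the simplex on $A$ and $p(A)=\frac12\sum_{i<j}|p_i-p_j|$. The strength is $\sigma(A)=V(A)^2/p(A)^{2n-1}$ (and $0$ if all points coincide). A number $\lambda_n>0$ is a Lipschitz constant of $\sigma$ if $|\sigma(A')-\sigma(A)|\le 2\varepsilon\lambda_n$ whenever the $(n+1)$-point cloud $A'$ is obtained from the $(n+1)$-point cloud $A$ by moving every point by at most $\varepsilon$. **Invariants.** For a base sequence $(p_1,\dots,p_n)$ and a finite set $Q$ of other points, let $D$ be the matrix of distances $|p_i-p_j|$, and let $M$ be the unordered collection of the columns $(v,s)$ for $q\in Q$, where $v=(|q-p_1|,\dots,|q-p_n|)$ and $s\in\{-1,0,1\}$ is the sign of $\det(q-p_1,\dots,q-p_n)$. A permutation $\xi$ of indices permutes rows and columns of $D$ and the first $n$ rows of $M$, and multiplies all signs $s$ by $\operatorname{sign}(\xi)$. For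 an $n$-point subset $A\subset C$, $\mathrm{ORD}(C;A)$ is the class of $[D;M]$ for $A$ (in any order) and $Q=C\setminus A$ under all $\xi\in S_n$; $\mathrm{OSD}(C)$ is the unordered collection (with multiplicities) of $\mathrm{ORD}(C;A)$ for all $n$-point subsets $A\subset C$. To define $\mathrm{SCD}(C)$ for a non-empty cloud $C$, translate $C$ so that its centre of mass is at $0$; for an $(n-1)$-point subset $A$ of the translated cloud, $\mathrm{OCD}(C;A)$ is the class of $[D;M]$ for the base sequence consisting of $A$ (in any order) followed by $0$, and $Q=C\setminus A$, under all permutations $\xi\in S_{n-1}$ of the points of $A$; $\mathrm{SCD}(C)$ is the unordered collection (with multiplicities) of these $\mathrm{OCD}(C;A)$. **Metrics.** Fix a Lipschitz constant $\lambda_n>0$ of $\sigma$. Replace every column $(v,s)$ of $M$ by the point $(v,\frac{s}{\lambda_n}\sigma)\in\mathbb{R}^{n+1}$, where $\sigma$ is the strength of the simplex on $q$ and the base sequence. For two collections of the same number of such points, the bottleneck distance $\mathrm{BD}$ is the minimum over all bijections $g$ of the maximum $L_\infty$ distance between matched points. The max metric between the classes of $[D;M]$ and $[D';M']$ is $$M_\infty=\min_{\xi}\max\{L_\infty(\xi(D),D'),\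 \mathrm{BD}(\xi(M),M')\},$$ minimised over $\xi\in S_n$ for $\mathrm{ORD}$s and over $\xi\in S_{n-1}$ for $\mathrm{OCD}$s. For two unordered collections of $k$ classes, $\mathrm{LAC}=\frac1k\min_g\sum_x M_\infty(x,g(x))$ over all bijections $g$. For $\mathrm{EMD}$, collapse any $l$ identical classes into one object of weight $l/k$; then $\mathrm{EMD}$ is the minimum of $\sum_{i,j}f_{ij}M_\infty(x_i,y_j)$ over $f_{ij}\in[0,1]$ with $\sum_j f_{ij}\le w(x_i)$, $\sum_i f_{ij}\le w(y_j)$, $\sum_{i,j}f_{ij}=1$. **Theorem.** The strength $\sigma$ in $\mathbb{R}^n$ has a Lipschitz constant $\lambda_n>0$. For any such constant $\lambda_n$ used in the metrics above, any $\varepsilon\ge0$, and any non-empty clouds $C,C'\subset\mathbb{R}^n$ of $m$ points such that $C'$ is obtained from $C$ by moving every point by at most $\varepsilon$ (that is, there is a bijection $g:C\to C'$ with $|p-g(p)|\le\varepsilon$ for all $p\in C$): * if $m\ge n$, then $\mathrm{LAC}(\mathrm{OSD}(C),\mathrm{OSD}(C'))\le2\varepsilon$ and $\mathrm{EMD}(\mathrm{OSD}(C),\mathrm{OSD}(C'))\le2\varepsilon$;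 * if $m\ge n-1$, then $\mathrm{LAC}(\mathrm{SCD}(C),\mathrm{SCD}(C'))\le2\varepsilon$ and $\mathrm{EMD}(\mathrm{SCD}(C),\mathrm{SCD}(C'))\le2\varepsilon$. -/

import Mathlib

open scoped ENNReal NNReal

/-! ### Strength of a simplex -/

/-- The Euclidean space `ℝⁿ`. A cloud in `ℝⁿ` is a `Finset (Pt n)`. -/
abbrev Pt (n : ℕ) : Type := EuclideanSpace ℝ (Fin n)

/-- Half of the sum of all pairwise distances between `n + 1` points of `ℝⁿ`
(every unordered pair of points is counted once). -/
noncomputable def halfPerimeter {n : ℕ} (A : Fin (n + 1) → Pt n) : ℝ :=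
  (∑ e : Fin (n + 1) × Fin (n + 1) with e.1 < e.2, dist (A e.1) (A e.2)) / 2

/-- The determinant of the matrix with the columns `q - p₁, …, q - pₙ`. -/
noncomputable def orientationDet {n : ℕ} (q : Pt n) (p : Fin n → Pt n) : ℝ :=
  (Matrix.of fun i j : Fin n => (q - p j) i).det

/-- The volume of the simplex on `n + 1` points `A 0, …, A n` of `ℝⁿ`. -/
noncomputable def simplexVolume {n : ℕ} (A : Fin (n + 1) → Pt n) : ℝ :=
  |orientationDet (A 0) (fun i => A i.succ)| / (n.factorial : ℝ)

/-- The strength `V² / p^(2n-1)` of the simplex on `n + 1` points of `ℝⁿ`, where `n ≥ 1`.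
If all points coincide, then the value is `0`, which is the limit value. -/
noncomputable def strength {n : ℕ} (A : Fin (n + 1) → Pt n) : ℝ :=
  simplexVolume A ^ 2 / halfPerimeter A ^ (2 * n - 1)

/-- `lam` is a Lipschitz constant of the strength in `ℝⁿ`: perturbing every point of an
`(n + 1)`-point cloud by at most `ε` changes the strength by at most `2 * ε * lam`. -/
def IsStrengthLipschitzConst (n : ℕ) (lam : ℝ) : Prop :=
  ∀ (ε : ℝ) (A A' : Fin (n + 1) → Pt n), Function.Injective A → Function.Injective A' →
    (∀ i, dist (A i) (A' i) ≤ ε) → |strength A' - strength A| ≤ 2 * ε * lam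

/-! ### Bottleneck distance, Linear Assignment Cost, Earth Mover's Distance -/

/-- A matching (bijection) between unordered collections `S` and `T`, written as the unordered
collection of all matched pairs `(x, g x)`. It exists only if `S` and `T` have the same size. -/
def IsMatching {X Y : Type*} (P : Multiset (X × Y)) (S : Multiset X) (T : Multiset Y) : Prop :=
  P.map Prod.fst = S ∧ P.map Prod.snd = T

/-- The bottleneck distance between finite unordered collections of points of a metric space
(equal to `∞` if there are no bijections). -/
noncomputable def bottleneckDist {X : Type*} [PseudoEMetricSpace X] (S T : Multiset X) : ℝ≥0∞ :=
  ⨅ (P : Multiset (X × X)) (_ : IsMatching P S T), ⨆ e ∈ P, edist e.1 e.2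

/-- The Linear Assignment Cost: the minimum average cost of a bijection between `S` and `T`. -/
noncomputable def linearAssignmentCost {X : Type*} (c : X → X → ℝ≥0∞) (S T : Multiset X) : ℝ≥0∞ :=
  ⨅ (P : Multiset (X × X)) (_ : IsMatching P S T), (P.map fun e => c e.1 e.2).sum / (S.card : ℝ≥0∞)

/-- `f` is a flow from the objects `x ∈ S` of weights `w x` to the objects `y ∈ T` of
weights `v y`. -/
structure IsFlow {X Y : Type*} (S : Finset X) (w : X → ℝ≥0) (T : Finset Y) (v : Y → ℝ≥0)
    (f : X → Y → ℝ≥0) : Prop where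
  le_one : ∀ x ∈ S, ∀ y ∈ T, f x y ≤ 1
  out_le : ∀ x ∈ S, ∑ y ∈ T, f x y ≤ w x
  in_le : ∀ y ∈ T, ∑ x ∈ S, f x y ≤ v y
  total : ∑ x ∈ S, ∑ y ∈ T, f x y = 1

/-- The Earth Mover's Distance between weighted distributions with a ground cost `c`. -/
noncomputable def weightedEMD {X : Type*} (c : X → X → ℝ≥0∞)
    (S : Finset X) (w : X → ℝ≥0) (T : Finset X) (v : X → ℝ≥0) : ℝ≥0∞ :=
  ⨅ (f : X → X → ℝ≥0) (_ : IsFlow S w T v f), ∑ x ∈ S, ∑ y ∈ T, (f x y : ℝ≥0∞) * c x y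

open scoped Classical in
/-- The Earth Mover's Distance between unordered collections of `k` and `k'` objects, where every
`l` identical objects are collapsed to one object of the weight `l / k` (respectively `l / k'`). -/
noncomputable def earthMoverDist {X : Type*} (c : X → X → ℝ≥0∞) (S T : Multiset X) : ℝ≥0∞ :=
  weightedEMD c S.toFinset (fun x => (S.count x : ℝ≥0) / (S.card : ℝ≥0))
    T.toFinset (fun y => (T.count y : ℝ≥0) / (T.card : ℝ≥0))

/-! ### Pairs `[D; M]` and their classes under permutations -/

/-- A pair `[D; M]`: an `n × n` matrix `D` of distances (written in full as a symmetric matrix),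
and an unordered collection of columns `(v, s)`, where `v` is a vector of `n` distances and `s` is
a sign. -/
@[ext] structure DistPair (n : ℕ) where
  D : Fin n → Fin n → ℝ
  M : Multiset ((Fin n → ℝ) × SignType)

/-- The sign of a permutation, as an element of `{-1, 0, 1}`. -/
noncomputable def permSign {n : ℕ} (ξ : Equiv.Perm (Fin n)) : SignType :=
  SignType.sign ((Equiv.Perm.sign ξ : ℤˣ) : ℤ)

theorem permSign_one {n : ℕ} : permSign (1 : Equiv.Perm (Fin n)) = 1 := by
  simp [permSign]

theorem permSign_mul {n : ℕ} (ξ η : Equiv.Perm (Fin n)) :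
    permSign (ξ * η) = permSign ξ * permSign η := by
  simp [permSign, sign_mul]

/-- A permutation `ξ` maps the entry `(i, j)` of `D` to the entry `(ξ i, ξ j)` and the `i`-th row of
`M` to the `ξ i`-th row, and multiplies all signs in the bottom row of `M` by the sign of `ξ`. -/
noncomputable instance distPairMulAction (n : ℕ) : MulAction (Equiv.Perm (Fin n)) (DistPair n) where
  smul ξ X :=
    { D := fun i j => X.D (ξ⁻¹ i) (ξ⁻¹ j)
      M := X.M.map fun c => (fun i => c.1 (ξ⁻¹ i), permSign ξ * c.2) }
  one_smul X := by
    ext1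
    · rfl
    · change X.M.map (fun c => (fun i => c.1 ((1 : Equiv.Perm (Fin n))⁻¹ i),
        permSign (1 : Equiv.Perm (Fin n)) * c.2)) = X.M
      simp [permSign_one]
  mul_smul ξ η X := by
    ext1
    · change (fun i j => X.D ((ξ * η)⁻¹ i) ((ξ * η)⁻¹ j)) =
        fun i j => X.D (η⁻¹ (ξ⁻¹ i)) (η⁻¹ (ξ⁻¹ j))
      simp [mul_inv_rev, Equiv.Perm.mul_apply]
    · change X.M.map (fun c => (fun i => c.1 ((ξ * η)⁻¹ i), permSign (ξ * η) * c.2)) =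
        (X.M.map fun c => (fun i => c.1 (η⁻¹ i), permSign η * c.2)).map
          fun c => (fun i => c.1 (ξ⁻¹ i), permSign ξ * c.2)
      simp [Multiset.map_map, permSign_mul, mul_assoc, mul_inv_rev,
        Equiv.Perm.mul_apply]

/-- The strength of the simplex on `q, p₁, …, pₙ` in `ℝⁿ` in terms of the distances
`D i j = |pᵢ - pⱼ|` and `v i = |q - pᵢ|` only: the squared volume is the Gram determinant of the
vectors `pᵢ - q` divided by `(n!)²`. Theorem `strengthOfDist_eq` justifies this formula. -/
noncomputable def strengthOfDist {n : ℕ} (D : Fin n → Fin n → ℝ) (v : Fin n → ℝ) : ℝ :=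
  ((Matrix.of fun i j : Fin n => (v i ^ 2 + v j ^ 2 - D i j ^ 2) / 2).det /
      (n.factorial : ℝ) ^ 2) /
    ((∑ i, v i + (∑ i, ∑ j, D i j) / 2) / 2) ^ (2 * n - 1)

theorem halfPerimeter_eq {n : ℕ} (q : Pt n) (p : Fin n → Pt n) :
    halfPerimeter (Fin.cons q p : Fin (n + 1) → Pt n) =
      (∑ i, dist q (p i) + (∑ i, ∑ j, dist (p i) (p j)) / 2) / 2 := by
  have key : ∀ {k : ℕ} (A : Fin k → Pt n),
      ∑ e : Fin k × Fin k with e.1 < e.2, dist (A e.1) (A e.2) =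
        (∑ i, ∑ j, dist (A i) (A j)) / 2 := by
    intro k A
    have h1 : ∑ e : Fin k × Fin k with e.1 < e.2, dist (A e.1) (A e.2) =
        ∑ i, ∑ j, if i < j then dist (A i) (A j) else 0 := by
      rw [Finset.sum_filter, Fintype.sum_prod_type]
    have h2 : ∑ i, ∑ j, (if i < j then dist (A i) (A j) else 0) =
        ∑ i, ∑ j, if j < i then dist (A i) (A j) else 0 := by
      rw [Finset.sum_comm]
      simp only [dist_comm]
    have h3 : ∑ i, ∑ j, dist (A i) (A j) =
        ∑ i, ∑ j, (if i < j then dist (A i) (A j) else 0) +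
          ∑ i, ∑ j, if j < i then dist (A i) (A j) else 0 := by
      rw [← Finset.sum_add_distrib]
      refine Finset.sum_congr rfl fun i _ => ?_
      rw [← Finset.sum_add_distrib]
      refine Finset.sum_congr rfl fun j _ => ?_
      rcases lt_trichotomy i j with h | h | h
      · simp [h, h.not_gt]
      · simp [h]
      · simp [h, h.not_gt]
    rw [h1, h3, ← h2]
    ring
  rw [halfPerimeter, key, Fin.sum_univ_succ]
  simp only [Fin.sum_univ_succ, Fin.cons_zero, Fin.cons_succ, dist_self, zero_add,
    Finset.sum_add_distrib]
  simp only [dist_comm (p _) q]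
  ring

theorem strengthOfDist_eq {n : ℕ} (q : Pt n) (p : Fin n → Pt n) :
    strengthOfDist (fun i j => dist (p i) (p j)) (fun i => dist q (p i)) =
      strength (Fin.cons q p : Fin (n + 1) → Pt n) := by
  unfold strengthOfDist strength simplexVolume
  rw [halfPerimeter_eq]
  congr 1
  simp only [Fin.cons_zero, Fin.cons_succ]
  rw [div_pow, sq_abs]
  congr 1
  have hG : (Matrix.of fun i j : Fin n =>
      (dist q (p i) ^ 2 + dist q (p j) ^ 2 - dist (p i) (p j) ^ 2) / 2) =
      (Matrix.of fun i j : Fin n => (q - p j) i).transpose *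
        (Matrix.of fun i j : Fin n => (q - p j) i) := by
    ext i j
    simp only [Matrix.of_apply, Matrix.mul_apply, Matrix.transpose_apply,
      EuclideanSpace.dist_sq_eq, Real.dist_eq, sq_abs, PiLp.sub_apply]
    rw [← Finset.sum_add_distrib, ← Finset.sum_sub_distrib, Finset.sum_div]
    exact Finset.sum_congr rfl fun k _ => by ring
  rw [hG, Matrix.det_mul, Matrix.det_transpose, orientationDet, sq]

theorem strengthOfDist_perm {n : ℕ} (D : Fin n → Fin n → ℝ) (v : Fin n → ℝ)
    (η : Equiv.Perm (Fin n)) :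
    strengthOfDist (fun i j => D (η i) (η j)) (fun i => v (η i)) = strengthOfDist D v := by
  unfold strengthOfDist
  have h1 : (Matrix.of fun i j : Fin n =>
      (v (η i) ^ 2 + v (η j) ^ 2 - D (η i) (η j) ^ 2) / 2).det =
      (Matrix.of fun i j : Fin n => (v i ^ 2 + v j ^ 2 - D i j ^ 2) / 2).det := by
    rw [← Matrix.det_submatrix_equiv_self η
      (Matrix.of fun i j : Fin n => (v i ^ 2 + v j ^ 2 - D i j ^ 2) / 2)]
    rfl
  have h2 : ∑ i, ∑ j, D (η i) (η j) = ∑ i, ∑ j, D i j := by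
    rw [← Equiv.sum_comp η (fun i => ∑ j, D i j)]
    exact Finset.sum_congr rfl fun i _ => Equiv.sum_comp η (fun j => D (η i) j)
  rw [h1, h2, Equiv.sum_comp η v]

/-- The columns `(v, s)` of `M` written as the points `(v, (s / lam) * σ)` of `ℝⁿ × ℝ = ℝⁿ⁺¹` with
the metric `L_∞`, where `σ` is the strength of the simplex on `A ∪ {q}`. -/
noncomputable def DistPair.points {n : ℕ} (lam : ℝ) (X : DistPair n) :
    Multiset ((Fin n → ℝ) × ℝ) :=
  X.M.map fun c => (c.1, ((c.2 : SignType) : ℝ) / lam * strengthOfDist X.D c.1)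

/-- The maximum of the `L_∞` distance between the matrices `D` and the bottleneck distance between
the matrices `M`. -/
noncomputable def DistPair.cost {n : ℕ} (lam : ℝ) (X Y : DistPair n) : ℝ≥0∞ :=
  max (edist X.D Y.D) (bottleneckDist (X.points lam) (Y.points lam))

theorem bottleneckDist_map_le {X : Type*} [PseudoEMetricSpace X] (φ : X → X)
    (h : ∀ a b, edist (φ a) (φ b) ≤ edist a b) (S T : Multiset X) :
    bottleneckDist (S.map φ) (T.map φ) ≤ bottleneckDist S T := by
  refine le_iInf₂ fun P hP => ?_
  refine (iInf₂_le (P.map (Prod.map φ φ)) ⟨?_, ?_⟩).trans ?_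
  · refine iSup₂_le fun e he => ?_
    obtain ⟨e', he', rfl⟩ := Multiset.mem_map.1 he
    exact (h _ _).trans (le_iSup₂ (f := fun (e : X × X) (_ : e ∈ P) => edist e.1 e.2) e' he')
  · rw [← hP.1, Multiset.map_map, Multiset.map_map]; rfl
  · rw [← hP.2, Multiset.map_map, Multiset.map_map]; rfl

theorem DistPair.points_smul {n : ℕ} (lam : ℝ) (ξ : Equiv.Perm (Fin n)) (X : DistPair n) :
    (ξ • X).points lam =
      (X.points lam).map fun c => (fun i => c.1 (ξ⁻¹ i), ((permSign ξ : SignType) : ℝ) * c.2) := by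
  change Multiset.map _ (X.M.map fun c => (fun i => c.1 (ξ⁻¹ i), permSign ξ * c.2)) = _
  rw [DistPair.points, Multiset.map_map, Multiset.map_map]
  refine Multiset.map_congr rfl fun c _ => Prod.ext rfl ?_
  have h : strengthOfDist (ξ • X).D (fun i => c.1 (ξ⁻¹ i)) = strengthOfDist X.D c.1 :=
    strengthOfDist_perm X.D c.1 ξ⁻¹
  simp only [Function.comp_apply, h, SignType.coe_mul]
  ring

theorem DistPair.cost_smul_le {n : ℕ} (lam : ℝ) (ξ : Equiv.Perm (Fin n)) (X Y : DistPair n) :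
    DistPair.cost lam (ξ • X) (ξ • Y) ≤ DistPair.cost lam X Y := by
  refine max_le_max ?_ ?_
  · exact edist_pi_le_iff.2 fun i => edist_pi_le_iff.2 fun j =>
      (edist_le_pi_edist (X.D (ξ⁻¹ i)) (Y.D (ξ⁻¹ i)) (ξ⁻¹ j)).trans
        (edist_le_pi_edist X.D Y.D (ξ⁻¹ i))
  · rw [DistPair.points_smul, DistPair.points_smul]
    refine bottleneckDist_map_le _ (fun a b => max_le_max ?_ ?_) _ _
    · exact edist_pi_le_iff.2 fun i => edist_le_pi_edist a.1 b.1 (ξ⁻¹ i)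
    · simp only [edist_dist, Real.dist_eq, ← mul_sub, abs_mul]
      refine ENNReal.ofReal_le_ofReal (mul_le_of_le_one_left (abs_nonneg _) ?_)
      rcases permSign ξ with _ | _ | _ <;> simp

theorem DistPair.cost_smul {n : ℕ} (lam : ℝ) (ξ : Equiv.Perm (Fin n)) (X Y : DistPair n) :
    DistPair.cost lam (ξ • X) (ξ • Y) = DistPair.cost lam X Y := by
  refine le_antisymm (DistPair.cost_smul_le lam ξ X Y) ?_
  simpa using DistPair.cost_smul_le lam ξ⁻¹ (ξ • X) (ξ • Y)

/-- Classes of pairs `[D; M]` up to the permutations from a group `G`. -/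
abbrev PairClass {n : ℕ} (G : Subgroup (Equiv.Perm (Fin n))) : Type :=
  MulAction.orbitRel.Quotient G (DistPair n)

/-- The max metric `M_∞` on classes of pairs: the minimum over all permutations `ξ` from `G`. -/
noncomputable def maxMetric {n : ℕ} (G : Subgroup (Equiv.Perm (Fin n))) (lam : ℝ) :
    PairClass G → PairClass G → ℝ≥0∞ :=
  Quotient.lift₂ (fun X Y => ⨅ ξ : G, DistPair.cost lam (ξ • X) Y) (by
    rintro _ _ X Y ⟨g, rfl⟩ ⟨h, rfl⟩
    refine Equiv.iInf_congr ((Equiv.mulLeft h⁻¹).trans (Equiv.mulRight g)) fun ξ => ?_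
    have e := DistPair.cost_smul lam (h : Equiv.Perm (Fin n))
      (((h⁻¹ * ξ * g : G) : Equiv.Perm (Fin n)) • X) Y
    simp only [smul_smul] at e
    simp only [Equiv.trans_apply, Equiv.coe_mulLeft, Equiv.coe_mulRight, Subgroup.smul_def]
    rw [← e]
    simp [mul_assoc, mul_smul])

/-! ### The invariants `OSD` and `SCD` -/

/-- The pair `[D; M]` of a base sequence `p₁, …, pₙ` and a finite set `Q` of other points `q`:
the column of `q ∈ Q` consists of the distances from `q` to `p₁, …, pₙ` and the sign of the
determinant on the vectors `q - p₁, …, q - pₙ`. -/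
noncomputable def relPair {n : ℕ} (Q : Finset (Pt n)) (p : Fin n → Pt n) : DistPair n where
  D := fun i j => dist (p i) (p j)
  M := Q.val.map fun q => (fun i => dist q (p i), SignType.sign (orientationDet q p))

/-- An ordering of a finite set of `k` points. -/
noncomputable def ordering {n k : ℕ} (A : Finset (Pt n)) (h : A.card = k) : Fin k → Pt n :=
  fun i => ((A.equivFinOfCardEq h).symm i : Pt n)

/-- Oriented Relative Distributions: classes of pairs up to all permutations of `n` points. -/
abbrev ORDClass (n : ℕ) : Type := PairClass (⊤ : Subgroup (Equiv.Perm (Fin n)))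

open scoped Classical in
/-- The Oriented Relative Distribution `ORD(C; A)` of an `n`-point subset `A` of a cloud `C` in `ℝⁿ`.
By `ORD_wellDefined`, it is independent of an ordering of `A`. -/
noncomputable def ORD {n : ℕ} (C A : Finset (Pt n)) (h : A.card = n) : ORDClass n :=
  Quotient.mk _ (relPair (C \ A) (ordering A h))

/-- The Oriented Simplexwise Distribution: the unordered collection of `ORD(C; A)` for all `n`-point
subsets `A` of a cloud `C` in `ℝⁿ`. -/
noncomputable def OSD {n : ℕ} (C : Finset (Pt n)) : Multiset (ORDClass n) :=
  (C.powersetCard n).attach.val.map fun A => ORD C A.1 (Finset.mem_powersetCard.1 A.2).2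

/-- The cloud `C` translated so that its centre of mass is at the origin. -/
noncomputable def centred {n : ℕ} (C : Finset (Pt n)) : Finset (Pt n) :=
  C.map (Equiv.subRight ((C.card : ℝ)⁻¹ • ∑ p ∈ C, p)).toEmbedding

/-- Oriented Centred Distributions in dimension `n + 1`: classes of pairs up to all permutations of
the first `n` points of a base sequence, whose last point is the origin. -/
abbrev OCDClass (n : ℕ) : Type :=
  PairClass (MulAction.stabilizer (Equiv.Perm (Fin (n + 1))) (Fin.last n))

open scoped Classical in
/-- The Oriented Centred Distribution `OCD(C; A)` of an `n`-point subset `A` of a cloud `C` in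
`ℝⁿ⁺¹` with the centre of mass at the origin. The base sequence is `A` with the origin added as the
last point, and columns are indexed by `q ∈ C - A`. By `OCD_wellDefined`, it is independent of an
ordering of `A`. -/
noncomputable def OCD {n : ℕ} (C A : Finset (Pt (n + 1))) (h : A.card = n) : OCDClass n :=
  Quotient.mk _ (relPair (C \ A) (Fin.snoc (ordering A h) 0))

/-- The Simplexwise Centred Distribution of a cloud `C` in `ℝⁿ⁺¹`: the cloud is translated so that
its centre of mass is at the origin, then `OCD`s of all `n`-point subsets are collected. -/
noncomputable def SCD {n : ℕ} (C : Finset (Pt (n + 1))) : Multiset (OCDClass n) :=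
  ((centred C).powersetCard n).attach.val.map fun A =>
    OCD (centred C) A.1 (Finset.mem_powersetCard.1 A.2).2

theorem orientationDet_perm {n : ℕ} (q : Pt n) (p : Fin n → Pt n) (η : Equiv.Perm (Fin n)) :
    SignType.sign (orientationDet q (p ∘ η)) = permSign η * SignType.sign (orientationDet q p) := by
  have h : orientationDet q (p ∘ η) = ((Equiv.Perm.sign η : ℤˣ) : ℤ) * orientationDet q p :=
    Matrix.det_permute' η (Matrix.of fun i j : Fin n => (q - p j) i)
  rw [h, sign_mul, permSign]
  rcases Int.units_eq_one_or (Equiv.Perm.sign η) with e | e <;> simp [e]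

theorem relPair_perm {n : ℕ} (Q : Finset (Pt n)) (p : Fin n → Pt n) (η : Equiv.Perm (Fin n)) :
    relPair Q (p ∘ η) = η⁻¹ • relPair Q p := by
  have hs : permSign η⁻¹ = permSign η := by simp [permSign]
  ext1
  · change (fun i j => dist (p (η i)) (p (η j))) =
      fun i j => dist (p (η⁻¹⁻¹ i)) (p (η⁻¹⁻¹ j))
    simp
  · change Q.val.map (fun q => (fun i => dist q (p (η i)), SignType.sign (orientationDet q (p ∘ η)))) =
      (Q.val.map fun q => (fun i => dist q (p i), SignType.sign (orientationDet q p))).map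
        fun c => (fun i => c.1 (η⁻¹⁻¹ i), permSign η⁻¹ * c.2)
    rw [Multiset.map_map]
    simp only [inv_inv, hs, orientationDet_perm]
    rfl

/-- Two orderings of the same finite set differ by a permutation. -/
theorem ordering_eq_comp {n k : ℕ} (A : Finset (Pt n)) (h : A.card = k) (p : Fin k → Pt n)
    (hA : ∀ x, x ∈ A ↔ ∃ i, p i = x) :
    ∃ η : Equiv.Perm (Fin k), ordering A h = p ∘ η := by
  have hmem : ∀ i, ∃ j, p j = ordering A h i := fun i =>
    (hA _).1 ((A.equivFinOfCardEq h).symm i).2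
  choose f hf using hmem
  have hinj : Function.Injective f := by
    intro i j hij
    have : ordering A h i = ordering A h j := by rw [← hf i, ← hf j, hij]
    exact (A.equivFinOfCardEq h).symm.injective (Subtype.ext this)
  exact ⟨Equiv.ofBijective f (Finite.injective_iff_bijective.1 hinj), funext fun i => (hf i).symm⟩

open scoped Classical in
theorem ORD_wellDefined {n : ℕ} (C A : Finset (Pt n)) (h : A.card = n) (p : Fin n → Pt n)
    (hA : ∀ x, x ∈ A ↔ ∃ i, p i = x) :
    ORD C A h = Quotient.mk _ (relPair (C \ A) p) := by
  obtain ⟨η, hη⟩ := ordering_eq_comp A h p hA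
  refine Quotient.sound ⟨⟨η⁻¹, trivial⟩, ?_⟩
  rw [hη, relPair_perm]
  rfl

open scoped Classical in
theorem OCD_wellDefined {n : ℕ} (C A : Finset (Pt (n + 1))) (h : A.card = n)
    (p : Fin n → Pt (n + 1)) (hA : ∀ x, x ∈ A ↔ ∃ i, p i = x) :
    OCD C A h = Quotient.mk _ (relPair (C \ A) (Fin.snoc p 0)) := by
  obtain ⟨η, hη⟩ := ordering_eq_comp A h p hA
  obtain ⟨ζ, hζ, hlast⟩ : ∃ ζ : Equiv.Perm (Fin (n + 1)),
      (∀ i : Fin n, ζ i.castSucc = (η i).castSucc) ∧ ζ (Fin.last n) = Fin.last n := by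
    let f : Fin (n + 1) → Fin (n + 1) :=
      Fin.snoc (α := fun _ => Fin (n + 1)) (fun i => (η i).castSucc) (Fin.last n)
    have hf1 : ∀ i : Fin n, f i.castSucc = (η i).castSucc := fun i => by simp [f]
    have hf2 : f (Fin.last n) = Fin.last n := by simp [f]
    have hf : Function.Injective f := by
      intro i j
      refine Fin.lastCases ?_ (fun i => ?_) i <;> refine Fin.lastCases ?_ (fun j => ?_) j
      · simp
      · rw [hf1, hf2]
        exact fun e => absurd e.symm (Fin.castSucc_lt_last _).ne
      · rw [hf1, hf2]
        exact fun e => absurd e (Fin.castSucc_lt_last _).ne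
      · rw [hf1, hf1]
        exact fun e => by rw [η.injective (Fin.castSucc_injective _ e)]
    exact ⟨Equiv.ofBijective f (Finite.injective_iff_bijective.1 hf), hf1, hf2⟩
  have hcomp : (Fin.snoc (α := fun _ => Pt (n + 1)) (ordering A h) 0) =
      (Fin.snoc (α := fun _ => Pt (n + 1)) p 0) ∘ ζ := by
    funext i
    refine Fin.lastCases ?_ (fun i => ?_) i
    · simp [hlast]
    · simp [hζ, hη]
  refine Quotient.sound ⟨(⟨ζ, hlast⟩ : MulAction.stabilizer _ (Fin.last n))⁻¹, ?_⟩
  rw [hcomp, relPair_perm]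
  rfl

/-! ### Lipschitz continuity of the strength -/

/-! The bijection of the clouds carries base subsets to base subsets, so it matches the two
collections of classes. LAC and EMD are bounded by the largest cost in this matching, so one pair of
corresponding classes with compatible orderings suffices. Distances change by at most `2 * ε` by the
triangle inequality.

The delicate coordinate is the sign times the strength, since the sign is discontinuous
(`IsStrengthLipschitzConst.abs_signedStrength_sub_le`). If the sign does not flip, the Lipschitz
bound applies directly. Otherwise the determinant vanishes somewhere on the straight-line motion
from `A` to `A'`; the strength is zero there, and the bounds on the two pieces of the motion add up
to the bound for the whole.

For SCD the centre moves too, and comparing the centred clouds directly would double the error.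
Translating one of them by the difference `w` of the centres restores the original displacements of
the points and moves the origin by `‖w‖ ≤ ε` (`relPair_cost_le`, `dist_centroid_le`).

A Lipschitz constant exists because the strength is homogeneous of degree one, with the determinant
and its increments controlled by powers of the perimeter (`abs_sq_div_pow_sub_le`). -/

theorem abs_det_le_prod_norm {n : ℕ} (m : Fin n → Fin n → ℝ) :
    |(Matrix.of m).det| ≤ (n.factorial : ℝ) * ∏ i, ‖m i‖ := by
  rw [Matrix.det_apply]
  refine (Finset.abs_sum_le_sum_abs _ _).trans ?_
  have h : ∀ η : Equiv.Perm (Fin n),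
      |Equiv.Perm.sign η • ∏ i, Matrix.of m (η i) i| ≤ ∏ i, ‖m i‖ := by
    intro η
    have h1 : |Equiv.Perm.sign η • ∏ i, Matrix.of m (η i) i| = ∏ i, |m (η i) i| := by
      rw [← Finset.abs_prod]
      rcases Int.units_eq_one_or (Equiv.Perm.sign η) with e | e <;> simp [e]
    rw [h1, ← Equiv.prod_comp η fun i => ‖m i‖]
    exact Finset.prod_le_prod (fun _ _ => abs_nonneg _) fun i _ => norm_le_pi_norm (m (η i)) i
  refine (Finset.sum_le_sum fun η _ => h η).trans ?_
  simp [Finset.card_univ, Fintype.card_perm]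

/-- Multilinearity in the rows: replacing them one at a time gives `n` terms, each bounded by the
Leibniz estimate. -/
theorem abs_det_sub_det_le {n : ℕ} (m m' : Fin n → Fin n → ℝ) :
    |(Matrix.of m).det - (Matrix.of m').det| ≤
      (n.factorial : ℝ) * n * max ‖m‖ ‖m'‖ ^ (n - 1) * ‖m - m'‖ := by
  have h := (Matrix.detRowAlternating (n := Fin n) (R := ℝ)).norm_image_sub_le_of_bound
    (Nat.cast_nonneg n.factorial) (fun m => abs_det_le_prod_norm m) m m'
  rwa [Fintype.card_fin] at h

/-- The vectors `A 0 - A 1, …, A 0 - A n` as rows of a matrix. -/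
def edgeRows {n : ℕ} (A : Fin (n + 1) → Pt n) : Fin n → Fin n → ℝ :=
  fun j i => (A 0 - A j.succ) i

theorem orientationDet_eq_det_edgeRows {n : ℕ} (A : Fin (n + 1) → Pt n) :
    orientationDet (A 0) (fun i => A i.succ) = (Matrix.of (edgeRows A)).det := by
  rw [orientationDet, ← Matrix.det_transpose]
  rfl

theorem halfPerimeter_nonneg {n : ℕ} (A : Fin (n + 1) → Pt n) : 0 ≤ halfPerimeter A :=
  div_nonneg (Finset.sum_nonneg fun _ _ => dist_nonneg) zero_le_two

theorem norm_edgeRows_le {n : ℕ} (A : Fin (n + 1) → Pt n) :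
    ‖edgeRows A‖ ≤ 2 * halfPerimeter A := by
  have h0 : 0 ≤ 2 * halfPerimeter A := mul_nonneg zero_le_two (halfPerimeter_nonneg A)
  refine (pi_norm_le_iff_of_nonneg h0).2 fun j => (pi_norm_le_iff_of_nonneg h0).2 fun i => ?_
  refine (PiLp.norm_apply_le (A 0 - A j.succ) i).trans ?_
  have hmem : ((0 : Fin (n + 1)), j.succ) ∈
      Finset.univ.filter fun e : Fin (n + 1) × Fin (n + 1) => e.1 < e.2 := by
    simp [Fin.succ_pos]
  have h := Finset.single_le_sum (f := fun e : Fin (n + 1) × Fin (n + 1) => dist (A e.1) (A e.2))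
    (fun _ _ => dist_nonneg) hmem
  rw [← dist_eq_norm, halfPerimeter]
  linarith

theorem norm_edgeRows_sub_le {n : ℕ} {A A' : Fin (n + 1) → Pt n} {ε : ℝ}
    (h : ∀ i, dist (A i) (A' i) ≤ ε) : ‖edgeRows A - edgeRows A'‖ ≤ 2 * ε := by
  have h0 : 0 ≤ 2 * ε := mul_nonneg zero_le_two (dist_nonneg.trans (h 0))
  refine (pi_norm_le_iff_of_nonneg h0).2 fun j => (pi_norm_le_iff_of_nonneg h0).2 fun i => ?_
  have h1 := (PiLp.norm_apply_le (A 0 - A' 0) i).trans ((dist_eq_norm _ _).symm.trans_le (h 0))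
  have h2 := (PiLp.norm_apply_le (A j.succ - A' j.succ) i).trans
    ((dist_eq_norm _ _).symm.trans_le (h j.succ))
  have h3 : (edgeRows A - edgeRows A') j i = (A 0 - A' 0) i - (A j.succ - A' j.succ) i := by
    simp only [edgeRows, Pi.sub_apply, PiLp.sub_apply]
    ring
  rw [h3]
  exact (norm_sub_le _ _).trans (by linarith)

theorem abs_dist_sub_dist_le {X : Type*} [PseudoMetricSpace X] {x y x' y' : X} {ε : ℝ}
    (hx : dist x x' ≤ ε) (hy : dist y y' ≤ ε) : |dist x y - dist x' y'| ≤ 2 * ε := by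
  rw [← Real.dist_eq]
  exact (dist_dist_dist_le x y x' y').trans (by linarith)

theorem abs_halfPerimeter_sub_le {n : ℕ} {A A' : Fin (n + 1) → Pt n} {ε : ℝ}
    (h : ∀ i, dist (A i) (A' i) ≤ ε) :
    |halfPerimeter A - halfPerimeter A'| ≤ ((n : ℝ) + 1) ^ 2 * ε := by
  have h0 : 0 ≤ ε := dist_nonneg.trans (h 0)
  rw [halfPerimeter, halfPerimeter, ← sub_div, ← Finset.sum_sub_distrib, abs_div, abs_two,
    div_le_iff₀ two_pos]
  refine (Finset.abs_sum_le_sum_abs _ _).trans <|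
    (Finset.sum_le_card_nsmul _ _ (2 * ε) fun e _ => abs_dist_sub_dist_le (h _) (h _)).trans ?_
  -- A crude count of the edges suffices, as any constant will do.
  have hc : ((Finset.univ.filter fun e : Fin (n + 1) × Fin (n + 1) => e.1 < e.2).card : ℝ) ≤
      ((n : ℝ) + 1) ^ 2 := by
    have := Finset.card_filter_le (Finset.univ : Finset (Fin (n + 1) × Fin (n + 1)))
      fun e => e.1 < e.2
    rw [Finset.card_univ, Fintype.card_prod, Fintype.card_fin] at this
    calc _ ≤ (((n + 1) * (n + 1) : ℕ) : ℝ) := by exact_mod_cast this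
      _ = _ := by push_cast; ring
  rw [nsmul_eq_mul]
  nlinarith

/-- A quotient `E ^ 2 / p ^ (2 * n + 1)` with `|E| ≤ K * p ^ (n + 1)` is Lipschitz in `E` and `p`
after scaling the increment of `E` by `p ^ n`. -/
theorem abs_sq_div_pow_sub_le {n : ℕ} {E E' p p' K L M ε : ℝ} (hp' : 0 ≤ p') (hpp : p' ≤ p)
    (hE : |E| ≤ K * p ^ (n + 1)) (hE' : |E'| ≤ K * p' ^ (n + 1)) (hK : 0 ≤ K)
    (hLε : 0 ≤ L * ε)
    (hL : |E - E'| ≤ L * p ^ n * ε) (hM : p - p' ≤ M * ε) :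
    |E ^ 2 / p ^ (2 * n + 1) - E' ^ 2 / p' ^ (2 * n + 1)| ≤
      (2 * K * L + K ^ 2 * (2 * n + 1) * M) * ε := by
  have hMε : 0 ≤ M * ε := (sub_nonneg.2 hpp).trans hM
  -- If `p = 0`, the growth bounds force `E = E' = 0`, so both quotients are `0`.
  rcases (hp'.trans hpp).eq_or_lt with h0 | hp
  · obtain rfl : p = 0 := h0.symm
    obtain rfl : p' = 0 := le_antisymm hpp hp'
    obtain rfl : E = 0 := by simpa using hE
    obtain rfl : E' = 0 := by simpa using hE'
    rw [sub_self, abs_zero]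
    have : 0 ≤ 2 * K * (L * ε) + K ^ 2 * (2 * n + 1) * (M * ε) := by positivity
    linarith
  have hE'p : |E'| ≤ K * p ^ (n + 1) := hE'.trans (by gcongr)
  -- Only the numerator changes, over the larger denominator: the factors `p ^ (n + 1)` and `p ^ n`
  -- cancel it exactly.
  have h1 : |E ^ 2 / p ^ (2 * n + 1) - E' ^ 2 / p ^ (2 * n + 1)| ≤ 2 * K * L * ε := by
    rw [← sub_div, abs_div, abs_of_pos (pow_pos hp _), div_le_iff₀ (pow_pos hp _), sq_sub_sq,
      abs_mul]
    calc |E + E'| * |E - E'| ≤ (K * p ^ (n + 1) + K * p ^ (n + 1)) * (L * p ^ n * ε) := by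
          gcongr
          exact (abs_add_le _ _).trans (add_le_add hE hE'p)
      _ = _ := by ring
  -- Only the denominator changes. Here `E' ^ 2` absorbs `p' ^ (2 * n + 1)` with one factor `p' ≤ p`
  -- to spare, which makes up the missing power of `p`.
  have h2 : |E' ^ 2 / p ^ (2 * n + 1) - E' ^ 2 / p' ^ (2 * n + 1)| ≤
      K ^ 2 * (2 * n + 1) * M * ε := by
    rcases hp'.eq_or_lt with h0 | hp'
    · obtain rfl : p' = 0 := h0.symm
      obtain rfl : E' = 0 := by simpa using hE'
      simp only [ne_eq, OfNat.ofNat_ne_zero, not_false_eq_true, zero_pow, zero_div, sub_self,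
        abs_zero]
      rw [mul_assoc]
      positivity
    have hpow := abs_pow_sub_pow_le p p' (2 * n + 1)
    rw [abs_of_pos hp, abs_of_pos hp', max_eq_left hpp, abs_of_nonneg (sub_nonneg.2 hpp),
      Nat.add_sub_cancel] at hpow
    have hs : E' ^ 2 ≤ (K * p' ^ (n + 1)) ^ 2 := sq_le_sq' (abs_le.1 hE').1 (abs_le.1 hE').2
    have hd : E' ^ 2 / p ^ (2 * n + 1) - E' ^ 2 / p' ^ (2 * n + 1) =
        -(E' ^ 2 * (p ^ (2 * n + 1) - p' ^ (2 * n + 1)) / (p ^ (2 * n + 1) * p' ^ (2 * n + 1))) := by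
      field_simp
      ring
    rw [hd, abs_neg, abs_div, abs_mul, abs_of_nonneg (sq_nonneg E'),
      abs_of_pos (by positivity : 0 < p ^ (2 * n + 1) * p' ^ (2 * n + 1)),
      div_le_iff₀ (by positivity)]
    calc E' ^ 2 * |p ^ (2 * n + 1) - p' ^ (2 * n + 1)|
        ≤ (K * p' ^ (n + 1)) ^ 2 * ((M * ε) * ((2 * n + 1 : ℕ) : ℝ) * p ^ (2 * n)) := by
          gcongr
          exact hpow.trans (by gcongr)
      _ = K ^ 2 * (2 * n + 1) * M * ε * (p ^ (2 * n) * p' * p' ^ (2 * n + 1)) := by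
          push_cast; ring
      _ ≤ K ^ 2 * (2 * n + 1) * M * ε * (p ^ (2 * n) * p * p' ^ (2 * n + 1)) := by
          rw [mul_assoc (K ^ 2 * (2 * n + 1))]
          gcongr
      _ = _ := by ring
  calc _ ≤ _ := abs_sub_le _ (E' ^ 2 / p ^ (2 * n + 1)) _
    _ ≤ 2 * K * L * ε + K ^ 2 * (2 * n + 1) * M * ε := add_le_add h1 h2
    _ = _ := by ring

theorem exists_abs_strength_sub_le (n : ℕ) :
    ∃ lam : ℝ, 0 < lam ∧ ∀ (ε : ℝ) (A A' : Fin (n + 2) → Pt (n + 1)),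
      (∀ i, dist (A i) (A' i) ≤ ε) → |strength A' - strength A| ≤ 2 * ε * lam := by
  set F : ℝ := ((n + 1).factorial : ℝ) with hF
  have hFpos : 0 < F := by positivity
  -- `K` bounds the determinant and `L` its increment, with rows of norm at most `2 * halfPerimeter
  -- A` moving by at most `2 * ε`; `M` bounds the increment of the half-perimeter.
  set K : ℝ := F * 2 ^ (n + 1)
  set L : ℝ := F * (n + 1) * 2 ^ n * 2
  set M : ℝ := ((n : ℝ) + 2) ^ 2
  set c : ℝ := 2 * K * L + K ^ 2 * (2 * n + 1) * M
  have hc : 0 < c := by positivity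
  have hdet : ∀ A : Fin (n + 2) → Pt (n + 1),
      |(Matrix.of (edgeRows A)).det| ≤ K * halfPerimeter A ^ (n + 1) := by
    intro A
    calc _ ≤ F * ∏ i, ‖edgeRows A i‖ := abs_det_le_prod_norm _
      _ ≤ F * ∏ _i : Fin (n + 1), (2 * halfPerimeter A) := by
          gcongr with i
          exact (norm_le_pi_norm _ i).trans (norm_edgeRows_le A)
      _ = _ := by simp only [Finset.prod_const, Finset.card_univ, Fintype.card_fin, mul_pow, K]; ring
  have hstr : ∀ A : Fin (n + 2) → Pt (n + 1), strength A =
      (Matrix.of (edgeRows A)).det ^ 2 / halfPerimeter A ^ (2 * n + 1) / F ^ 2 := by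
    intro A
    rw [strength, simplexVolume, orientationDet_eq_det_edgeRows, div_pow, sq_abs, div_right_comm]
    rfl
  -- By symmetry the larger half-perimeter may be assumed to belong to `A`.
  have main : ∀ (ε : ℝ) (A A' : Fin (n + 2) → Pt (n + 1)), (∀ i, dist (A i) (A' i) ≤ ε) →
      halfPerimeter A' ≤ halfPerimeter A → |strength A' - strength A| ≤ 2 * ε * (c / F ^ 2) := by
    intro ε A A' h hle
    have hε : 0 ≤ ε := dist_nonneg.trans (h 0)
    have hL : |(Matrix.of (edgeRows A)).det - (Matrix.of (edgeRows A')).det| ≤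
        L * halfPerimeter A ^ n * ε := by
      refine (abs_det_sub_det_le _ _).trans ?_
      calc _ ≤ F * ((n + 1 : ℕ) : ℝ) * (2 * halfPerimeter A) ^ n * (2 * ε) := by
            have h1 := norm_edgeRows_sub_le h
            have h0 := halfPerimeter_nonneg A
            have h2 : max ‖edgeRows A‖ ‖edgeRows A'‖ ≤ 2 * halfPerimeter A :=
              max_le (norm_edgeRows_le A) ((norm_edgeRows_le A').trans (by linarith))
            rw [Nat.add_sub_cancel]
            gcongr
        _ = _ := by push_cast; rw [mul_pow]; ring
    have hM : halfPerimeter A - halfPerimeter A' ≤ M * ε := by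
      refine (le_abs_self _).trans ((abs_halfPerimeter_sub_le h).trans_eq ?_)
      push_cast
      ring
    have := abs_sq_div_pow_sub_le (halfPerimeter_nonneg A') hle (hdet A) (hdet A')
      (by positivity) (by positivity) hL hM
    rw [abs_sub_comm, hstr, hstr, ← sub_div, abs_div, abs_of_pos (by positivity : 0 < F ^ 2),
      ← mul_div_assoc]
    gcongr
    refine this.trans ?_
    nlinarith
  refine ⟨c / F ^ 2, by positivity, fun ε A A' h => ?_⟩
  rcases le_total (halfPerimeter A') (halfPerimeter A) with hle | hle
  · exact main ε A A' h hle
  · rw [abs_sub_comm]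
    exact main ε A' A (fun i => by rw [dist_comm]; exact h i) hle

/-! ### Extension to simplices with coinciding vertices -/

theorem continuous_strength (n : ℕ) :
    Continuous (strength : (Fin (n + 2) → Pt (n + 1)) → ℝ) := by
  obtain ⟨lam, hlam, h⟩ := exists_abs_strength_sub_le n
  refine (LipschitzWith.of_dist_le_mul (K := ⟨2 * lam, by positivity⟩) fun A A' => ?_).continuous
  have h1 := h (dist A A') A A' (dist_le_pi_dist A A')
  rw [Real.dist_eq, abs_sub_comm]
  refine h1.trans_eq ?_
  change 2 * dist A A' * lam = 2 * lam * dist A A'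
  ring

/-- Vertices drift along one direction at distinct speeds: coinciding ones separate at once, and
distinct ones stay apart for small `t`. -/
theorem eventually_injective_add_smul {n : ℕ} (A : Fin (n + 2) → Pt (n + 1)) :
    ∀ᶠ t : ℝ in nhdsWithin 0 {0}ᶜ, Function.Injective fun i : Fin (n + 2) =>
      A i + t • (i : ℝ) • (EuclideanSpace.single 0 1 : Pt (n + 1)) := by
  simp only [Function.Injective, Filter.eventually_all]
  intro i j
  by_cases hij : i = j
  · exact Filter.Eventually.of_forall fun _ _ => hij
  set u : Pt (n + 1) := EuclideanSpace.single 0 1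
  have hu : u ≠ 0 := by simp [u]
  have hij' : (i : ℝ) - (j : ℝ) ≠ 0 := sub_ne_zero.2 fun e => hij (Fin.ext (by exact_mod_cast e))
  have hsub : ∀ t : ℝ, A i + t • (i : ℝ) • u = A j + t • (j : ℝ) • u →
      A i - A j + t • ((i : ℝ) - (j : ℝ)) • u = 0 := fun t ht => by
    rw [sub_smul, smul_sub, ← add_sub_assoc, sub_add_eq_add_sub, ht]
    abel
  by_cases hA : A i = A j
  · filter_upwards [self_mem_nhdsWithin] with t ht e
    have := hsub t e
    rw [hA, sub_self, zero_add] at this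
    exact absurd this (smul_ne_zero ht (smul_ne_zero hij' hu))
  · have hc : ContinuousAt (fun t : ℝ => A i - A j + t • ((i : ℝ) - (j : ℝ)) • u) 0 := by fun_prop
    have := hc.eventually_ne (y := 0) (by simpa using sub_ne_zero.2 hA)
    filter_upwards [nhdsWithin_le_nhds this] with t ht e
    exact absurd (hsub t e) ht

/-- By continuity, a Lipschitz constant of the strength also works for degenerate simplices with
coinciding vertices. -/
theorem IsStrengthLipschitzConst.abs_strength_sub_le {n : ℕ} {lam : ℝ}
    (h : IsStrengthLipschitzConst (n + 1) lam) {ε : ℝ} {A A' : Fin (n + 2) → Pt (n + 1)}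
    (hA : ∀ i, dist (A i) (A' i) ≤ ε) : |strength A' - strength A| ≤ 2 * ε * lam := by
  set pert : (Fin (n + 2) → Pt (n + 1)) → ℝ → Fin (n + 2) → Pt (n + 1) := fun B t i =>
    B i + t • (i : ℝ) • (EuclideanSpace.single 0 1 : Pt (n + 1)) with hpert
  have hlim : ∀ B, Filter.Tendsto (fun t => strength (pert B t)) (nhdsWithin 0 {0}ᶜ)
      (nhds (strength B)) := by
    intro B
    have hc : Continuous fun t => strength (pert B t) :=
      (continuous_strength n).comp (by fun_prop)
    have := hc.tendsto 0
    simp only [hpert, zero_smul, add_zero] at this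
    exact this.mono_left nhdsWithin_le_nhds
  refine le_of_tendsto ((hlim A').sub (hlim A)).abs ?_
  filter_upwards [eventually_injective_add_smul A, eventually_injective_add_smul A'] with t h1 h2
  -- Both families receive the same shift, so the displacements are unchanged.
  exact h ε _ _ h1 h2 fun i => by simpa [hpert] using hA i

/-! ### The signed strength -/

/-- The strength of a simplex multiplied by the sign of its orientation. -/
noncomputable def signedStrength {n : ℕ} (A : Fin (n + 1) → Pt n) : ℝ :=
  (SignType.sign (orientationDet (A 0) fun i => A i.succ) : ℝ) * strength A

theorem strength_nonneg {n : ℕ} (A : Fin (n + 1) → Pt n) : 0 ≤ strength A :=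
  div_nonneg (sq_nonneg _) (pow_nonneg (halfPerimeter_nonneg A) _)

theorem abs_signedStrength_le {n : ℕ} (A : Fin (n + 1) → Pt n) :
    |signedStrength A| ≤ strength A := by
  rw [signedStrength, abs_mul, abs_of_nonneg (strength_nonneg A)]
  refine mul_le_of_le_one_left (strength_nonneg A) ?_
  rcases SignType.sign (orientationDet (A 0) fun i => A i.succ) with _ | _ | _ <;> simp

theorem strength_eq_zero {n : ℕ} {A : Fin (n + 1) → Pt n}
    (h : orientationDet (A 0) (fun i => A i.succ) = 0) : strength A = 0 := by
  simp [strength, simplexVolume, h]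

theorem signedStrength_add_right {n : ℕ} (A : Fin (n + 1) → Pt n) (w : Pt n) :
    signedStrength (fun i => A i + w) = signedStrength A := by
  simp only [signedStrength, strength, simplexVolume, halfPerimeter, orientationDet,
    add_sub_add_right_eq_sub, dist_add_right]

/-- The sign may jump only across degenerate simplices, where the strength vanishes, so the constant
survives without doubling. -/
theorem IsStrengthLipschitzConst.abs_signedStrength_sub_le {n : ℕ} {lam : ℝ}
    (h : IsStrengthLipschitzConst (n + 1) lam) {ε : ℝ}
    {A A' : Fin (n + 2) → Pt (n + 1)} (hA : ∀ i, dist (A i) (A' i) ≤ ε) :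
    |signedStrength A - signedStrength A'| ≤ 2 * ε * lam := by
  set d : (Fin (n + 2) → Pt (n + 1)) → ℝ := fun B => orientationDet (B 0) fun i => B i.succ with hd
  rcases le_or_gt (d A * d A') 0 with hneg | hpos
  · set B : ℝ → Fin (n + 2) → Pt (n + 1) := fun t i => AffineMap.lineMap (A i) (A' i) t with hB
    have hB0 : B 0 = A := by simp [hB]
    have hB1 : B 1 = A' := by simp [hB]
    have hcont : Continuous fun t => d (B t) := by
      simp only [hd, hB, orientationDet, AffineMap.lineMap_apply_module]
      refine Continuous.matrix_det (continuous_matrix fun i j => ?_)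
      simp only [Matrix.of_apply]
      fun_prop
    have h0 : (0 : ℝ) ∈ Set.uIcc (d (B 0)) (d (B 1)) := by
      rw [hB0, hB1, Set.mem_uIcc]
      rcases mul_nonpos_iff.1 hneg with h | h
      · exact Or.inr h.symm
      · exact Or.inl h
    obtain ⟨t, ht, ht0⟩ := intermediate_value_uIcc hcont.continuousOn h0
    rw [Set.uIcc_of_le zero_le_one] at ht
    have hz : strength (B t) = 0 := strength_eq_zero ht0
    -- Vertices of `B t` may collide, so the bound without injectivity is needed. The budgets `t *
    -- ε` and `(1 - t) * ε` sum to `ε`.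
    have h1 := h.abs_strength_sub_le (A := A) (A' := B t) (ε := t * ε) fun i => by
      rw [dist_left_lineMap, Real.norm_of_nonneg ht.1]
      exact mul_le_mul_of_nonneg_left (hA i) ht.1
    have h2 := h.abs_strength_sub_le (A := B t) (A' := A') (ε := (1 - t) * ε) fun i => by
      rw [dist_lineMap_right, Real.norm_of_nonneg (sub_nonneg.2 ht.2)]
      exact mul_le_mul_of_nonneg_left (hA i) (sub_nonneg.2 ht.2)
    rw [hz, zero_sub, abs_neg, abs_of_nonneg (strength_nonneg A)] at h1
    rw [hz, sub_zero, abs_of_nonneg (strength_nonneg A')] at h2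
    have h3 := abs_signedStrength_le A
    have h4 := abs_signedStrength_le A'
    have h5 := abs_sub (signedStrength A) (signedStrength A')
    linarith
  · have hs := h.abs_strength_sub_le hA
    rw [abs_sub_comm] at hs
    simp only [signedStrength]
    rcases pos_and_pos_or_neg_and_neg_of_mul_pos hpos with ⟨h1, h2⟩ | ⟨h1, h2⟩
    · rw [sign_pos h1, sign_pos h2]
      simpa using hs
    · rw [sign_neg h1, sign_neg h2]
      rw [abs_sub_comm] at hs
      simpa [neg_add_eq_sub] using hs

/-! ### Distances between pairs under perturbations -/

theorem relPair_points {n : ℕ} (lam : ℝ) (Q : Finset (Pt n)) (p : Fin n → Pt n) :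
    (relPair Q p).points lam =
      Q.val.map fun q => (fun i => dist q (p i), signedStrength (Fin.cons q p) / lam) := by
  rw [DistPair.points, relPair, Multiset.map_map]
  refine Multiset.map_congr rfl fun q _ => Prod.ext rfl ?_
  simp only [Function.comp_apply, strengthOfDist_eq, signedStrength, Fin.cons_zero, Fin.cons_succ]
  ring

/-- Distances and signed strengths are translation invariant, so displacements may be measured after
any shift `w`. OSD needs `w = 0`; SCD needs the difference of the centres. -/
theorem relPair_cost_le {n : ℕ} {lam : ℝ} (hlam : 0 < lam)
    (h : IsStrengthLipschitzConst (n + 1) lam) {ι : Type*} (S : Finset ι) (c c' : ι ↪ Pt (n + 1))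
    (p p' : Fin (n + 1) → Pt (n + 1)) (w : Pt (n + 1)) {ε : ℝ}
    (hc : ∀ i, dist (c i) (c' i + w) ≤ ε) (hp : ∀ j, dist (p j) (p' j + w) ≤ ε) :
    DistPair.cost lam (relPair (S.map c) p) (relPair (S.map c') p') ≤ ENNReal.ofReal (2 * ε) := by
  have hdist : ∀ {x x' y y' : Pt (n + 1)}, dist x (x' + w) ≤ ε → dist y (y' + w) ≤ ε →
      edist (dist x y) (dist x' y') ≤ ENNReal.ofReal (2 * ε) := by
    intro x x' y y' hx hy
    rw [edist_dist, Real.dist_eq, ← dist_add_right x' y' w]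
    exact ENNReal.ofReal_le_ofReal (abs_dist_sub_dist_le hx hy)
  refine max_le ?_ ?_
  · exact edist_pi_le_iff.2 fun i => edist_pi_le_iff.2 fun j => hdist (hp i) (hp j)
  · rw [relPair_points, relPair_points, Finset.map_val, Finset.map_val, Multiset.map_map,
      Multiset.map_map]
    -- Columns are matched by their common index in `S`.
    refine (iInf₂_le (S.val.map fun i =>
      (((fun j => dist (c i) (p j)), signedStrength (Fin.cons (c i) p) / lam),
        ((fun j => dist (c' i) (p' j)), signedStrength (Fin.cons (c' i) p') / lam)))
      ⟨by rw [Multiset.map_map]; rfl, by rw [Multiset.map_map]; rfl⟩).trans ?_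
    refine iSup₂_le fun e he => ?_
    obtain ⟨i, -, rfl⟩ := Multiset.mem_map.1 he
    refine max_le (edist_pi_le_iff.2 fun j => hdist (hc i) (hp j)) ?_
    simp only [edist_dist, Real.dist_eq]
    rw [← sub_div, abs_div, abs_of_pos hlam]
    refine ENNReal.ofReal_le_ofReal ((div_le_iff₀ hlam).2 ?_)
    rw [← signedStrength_add_right (Fin.cons (c' i) p') w]
    refine h.abs_signedStrength_sub_le fun j => ?_
    refine Fin.cases ?_ (fun j => ?_) j
    · exact hc i
    · exact hp j

/-- The identity of `G` suffices once representatives are ordered compatibly. -/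
theorem maxMetric_mk_le {n : ℕ} (G : Subgroup (Equiv.Perm (Fin n))) (lam : ℝ) (X Y : DistPair n) :
    maxMetric G lam (Quotient.mk _ X) (Quotient.mk _ Y) ≤ DistPair.cost lam X Y :=
  (iInf_le (fun ξ : G => DistPair.cost lam (ξ • X) Y) 1).trans_eq (by rw [one_smul])

/-! ### Distances between collections from a matching -/

theorem IsMatching.card_eq {X Y : Type*} {P : Multiset (X × Y)} {S : Multiset X} {T : Multiset Y}
    (h : IsMatching P S T) : P.card = S.card ∧ P.card = T.card := by
  rw [← h.1, ← h.2, Multiset.card_map, Multiset.card_map]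
  exact ⟨rfl, rfl⟩

theorem linearAssignmentCost_le {X : Type*} {c : X → X → ℝ≥0∞} {S T : Multiset X}
    {P : Multiset (X × X)} (hP : IsMatching P S T) {b : ℝ≥0∞} (hb : ∀ e ∈ P, c e.1 e.2 ≤ b) :
    linearAssignmentCost c S T ≤ b := by
  refine (iInf₂_le P hP).trans (ENNReal.div_le_of_le_mul ?_)
  refine (Multiset.sum_le_card_nsmul _ b fun x hx => ?_).trans_eq ?_
  · obtain ⟨e, he, rfl⟩ := Multiset.mem_map.1 hx
    exact hb e he
  · rw [Multiset.card_map, hP.card_eq.1, nsmul_eq_mul, mul_comm]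

open scoped Classical in
theorem Multiset.sum_count_prodMk_right {X Y : Type*} (P : Multiset (X × Y)) (x : X) :
    ∑ y ∈ (P.map Prod.snd).toFinset, P.count (x, y) = (P.map Prod.fst).count x := by
  -- The range of summation stays tied to `P` while the induction runs over its sub-multisets.
  have h : ∀ R : Multiset (X × Y), R ≤ P →
      ∑ y ∈ (P.map Prod.snd).toFinset, R.count (x, y) = (R.map Prod.fst).count x := by
    intro R
    induction R using Multiset.induction with
    | empty => simp
    | cons e R ih =>
      intro hR
      have he : e.2 ∈ (P.map Prod.snd).toFinset := Multiset.mem_toFinset.2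
        (Multiset.mem_map_of_mem _ (Multiset.mem_of_le hR (Multiset.mem_cons_self e R)))
      have hsum : ∑ y ∈ (P.map Prod.snd).toFinset, (if (x, y) = e then 1 else 0) =
          if x = e.1 then 1 else 0 := by
        rw [Finset.sum_eq_single_of_mem e.2 he]
        · simp [Prod.ext_iff]
        · intro y _ hy
          simp [Prod.ext_iff, hy]
      simp only [Multiset.count_cons, Finset.sum_add_distrib, Multiset.map_cons, hsum,
        ih ((Multiset.le_cons_self R e).trans hR)]
  exact h P le_rfl

open scoped Classical in
theorem Multiset.sum_count_prodMk_left {X Y : Type*} (P : Multiset (X × Y)) (y : Y) :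
    ∑ x ∈ (P.map Prod.fst).toFinset, P.count (x, y) = (P.map Prod.snd).count y := by
  have h := Multiset.sum_count_prodMk_right (P.map Prod.swap) y
  rw [Multiset.map_map, Multiset.map_map] at h
  change ∑ x ∈ (P.map Prod.fst).toFinset, _ = (P.map Prod.snd).count y at h
  rw [← h]
  exact Finset.sum_congr rfl fun x _ =>
    (Multiset.count_map_eq_count' _ _ Prod.swap_injective (x, y)).symm

/-- A matching is a flow: send from `x` to `y` the proportion of matched pairs equal to `(x, y)`.
Its marginals are exactly the weights; nonemptiness makes the total `1`. -/
theorem earthMoverDist_le {X : Type*} {c : X → X → ℝ≥0∞} {S T : Multiset X}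
    {P : Multiset (X × X)} (hP : IsMatching P S T) (hS : S ≠ 0) {b : ℝ≥0∞}
    (hb : ∀ e ∈ P, c e.1 e.2 ≤ b) : earthMoverDist c S T ≤ b := by
  classical
  obtain ⟨hPS, hPT⟩ := hP.card_eq
  obtain ⟨rfl, rfl⟩ := hP
  set k : ℝ≥0 := (P.card : ℝ≥0) with hk
  have hk0 : k ≠ 0 := by
    rw [hk, hPS]
    exact_mod_cast (Multiset.card_pos.2 hS).ne'
  have hout : ∀ x, ∑ y ∈ (P.map Prod.snd).toFinset, (P.count (x, y) : ℝ≥0) / k =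
      ((P.map Prod.fst).count x : ℝ≥0) / k := fun x => by
    rw [← Finset.sum_div, ← Nat.cast_sum, Multiset.sum_count_prodMk_right]
  have hin : ∀ y, ∑ x ∈ (P.map Prod.fst).toFinset, (P.count (x, y) : ℝ≥0) / k =
      ((P.map Prod.snd).count y : ℝ≥0) / k := fun y => by
    rw [← Finset.sum_div, ← Nat.cast_sum, Multiset.sum_count_prodMk_left]
  have htotal : ∑ x ∈ (P.map Prod.fst).toFinset, ∑ y ∈ (P.map Prod.snd).toFinset,
      (P.count (x, y) : ℝ≥0) / k = 1 := by
    simp only [hout]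
    rw [← Finset.sum_div, ← Nat.cast_sum, Multiset.toFinset_sum_count_eq, ← hPS]
    exact div_self hk0
  have hflow : IsFlow (P.map Prod.fst).toFinset
      (fun x => ((P.map Prod.fst).count x : ℝ≥0) / k) (P.map Prod.snd).toFinset
      (fun y => ((P.map Prod.snd).count y : ℝ≥0) / k) fun x y => (P.count (x, y) : ℝ≥0) / k :=
    ⟨fun x _ y _ => div_le_one_of_le₀ (by rw [hk]; exact_mod_cast Multiset.count_le_card _ _)
      zero_le, fun x _ => (hout x).le, fun y _ => (hin y).le, htotal⟩
  have hcost : ∑ x ∈ (P.map Prod.fst).toFinset, ∑ y ∈ (P.map Prod.snd).toFinset,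
      (((P.count (x, y) : ℝ≥0) / k : ℝ≥0) : ℝ≥0∞) * c x y ≤ b := by
    calc _ ≤ ∑ x ∈ (P.map Prod.fst).toFinset, ∑ y ∈ (P.map Prod.snd).toFinset,
          (((P.count (x, y) : ℝ≥0) / k : ℝ≥0) : ℝ≥0∞) * b := by
          refine Finset.sum_le_sum fun x _ => Finset.sum_le_sum fun y _ => ?_
          -- Nothing is known about the cost of an unmatched pair, but it carries zero flow.
          by_cases hxy : (x, y) ∈ P
          · exact mul_le_mul_right (hb _ hxy) _
          · simp [Multiset.count_eq_zero_of_notMem hxy]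
      _ = b := by
          simp only [← Finset.sum_mul, ← ENNReal.ofNNReal_finsetSum, htotal]
          simp
  unfold earthMoverDist weightedEMD
  rw [← hPS, ← hPT, ← hk]
  refine (iInf₂_le _ hflow).trans ?_
  exact hcost

/-! ### Stability of the invariants -/

theorem Finset.map_attach_powersetCard_map {α β X : Type*} (k : ℕ) (s : Finset α) (c : α ↪ β)
    (F : ∀ A : Finset β, A.card = k → X) :
    ((s.map c).powersetCard k).attach.val.map
        (fun A => F A.1 (Finset.mem_powersetCard.1 A.2).2) =
      (s.powersetCard k).attach.val.map fun A =>
        F (A.1.map c) ((Finset.card_map c).trans (Finset.mem_powersetCard.1 A.2).2) := by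
  classical
  -- A default value in `X` extends `F` to all finite sets, removing its dependence on the
  -- cardinality proof. If `X` is empty, there are no `k`-point subsets.
  rcases isEmpty_or_nonempty X with hX | ⟨⟨x⟩⟩
  · have h : ∀ t : Finset β, (t.powersetCard k).attach = ∅ := fun t =>
      Finset.eq_empty_of_forall_notMem fun A _ =>
        hX.elim (F A.1 (Finset.mem_powersetCard.1 A.2).2)
    have h' : (s.powersetCard k).attach = ∅ := Finset.eq_empty_of_forall_notMem fun A _ =>
      hX.elim (F (A.1.map c) ((Finset.card_map c).trans (Finset.mem_powersetCard.1 A.2).2))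
    rw [h, h']
    rfl
  set F' : Finset β → X := fun A => if h : A.card = k then F A h else x with hF'
  have hF : ∀ A h, F A h = F' A := fun A h => (dif_pos h).symm
  simp only [hF]
  change Multiset.map (fun A => F' A.1) (Multiset.attach _) =
    Multiset.map (fun A => F' (A.1.map c)) (Multiset.attach (s.powersetCard k).val)
  rw [Multiset.attach_map_val' _ F', Finset.powersetCard_map, Finset.map_val, Multiset.map_map]
  exact (Multiset.attach_map_val' _ fun A : Finset α => F' (A.map c)).symm

/-- Two collections indexed by the `k`-point subsets of two clouds with the same index set are close
if their corresponding elements are close. -/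
theorem linearAssignmentCost_and_earthMoverDist_le {ι β X : Type*} [Fintype ι] {k : ℕ}
    (hk : k ≤ Fintype.card ι) (cost : X → X → ℝ≥0∞) (c c' : ι ↪ β)
    (F F' : ∀ A : Finset β, A.card = k → X) {b : ℝ≥0∞}
    (hb : ∀ (A : Finset ι) (h : A.card = k), cost (F (A.map c) ((Finset.card_map c).trans h))
      (F' (A.map c') ((Finset.card_map c').trans h)) ≤ b) :
    let S := ((Finset.univ.map c).powersetCard k).attach.val.map
      fun A => F A.1 (Finset.mem_powersetCard.1 A.2).2
    let T := ((Finset.univ.map c').powersetCard k).attach.val.map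
      fun A => F' A.1 (Finset.mem_powersetCard.1 A.2).2
    linearAssignmentCost cost S T ≤ b ∧ earthMoverDist cost S T ≤ b := by
  intro S T
  set P : Multiset (X × X) := ((Finset.univ : Finset ι).powersetCard k).attach.val.map fun A =>
    (F (A.1.map c) ((Finset.card_map c).trans (Finset.mem_powersetCard.1 A.2).2),
      F' (A.1.map c') ((Finset.card_map c').trans (Finset.mem_powersetCard.1 A.2).2)) with hPdef
  have hP : IsMatching P S T := by
    constructor
    · rw [hPdef, Multiset.map_map]
      exact (Finset.map_attach_powersetCard_map k Finset.univ c F).symm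
    · rw [hPdef, Multiset.map_map]
      exact (Finset.map_attach_powersetCard_map k Finset.univ c' F').symm
  have hPb : ∀ e ∈ P, cost e.1 e.2 ≤ b := by
    intro e he
    obtain ⟨A, -, rfl⟩ := Multiset.mem_map.1 he
    exact hb A.1 (Finset.mem_powersetCard.1 A.2).2
  refine ⟨linearAssignmentCost_le hP hPb, earthMoverDist_le hP ?_ hPb⟩
  rw [← Multiset.card_pos, ← hP.card_eq.1, hPdef, Multiset.card_map, Finset.card_val,
    Finset.card_attach, Finset.card_powersetCard, Finset.card_univ]
  -- EMD needs a nonempty collection, hence `k ≤ Fintype.card ι`.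
  exact Nat.choose_pos hk

/-- A sequence listing the points of a finite set. -/
theorem Finset.exists_fin_enum {ι : Type*} (A : Finset ι) {k : ℕ} (h : A.card = k) :
    ∃ e : Fin k → ι, ∀ x, x ∈ A ↔ ∃ i, e i = x := by
  refine ⟨fun i => (A.equivFinOfCardEq h).symm i, fun x => ⟨fun hx => ?_, ?_⟩⟩
  · exact ⟨A.equivFinOfCardEq h ⟨x, hx⟩, by simp⟩
  · rintro ⟨i, rfl⟩
    exact ((A.equivFinOfCardEq h).symm i).2

theorem OSD_stable {n : ℕ} {lam : ℝ} (hlam : 0 < lam) (h : IsStrengthLipschitzConst (n + 1) lam)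
    {ι : Type*} [Fintype ι] (hι : n + 1 ≤ Fintype.card ι) (c c' : ι ↪ Pt (n + 1)) {ε : ℝ}
    (hc : ∀ i, dist (c i) (c' i) ≤ ε) :
    linearAssignmentCost (maxMetric ⊤ lam) (OSD (Finset.univ.map c)) (OSD (Finset.univ.map c')) ≤
        ENNReal.ofReal (2 * ε) ∧
      earthMoverDist (maxMetric ⊤ lam) (OSD (Finset.univ.map c)) (OSD (Finset.univ.map c')) ≤
        ENNReal.ofReal (2 * ε) := by
  classical
  refine linearAssignmentCost_and_earthMoverDist_le hι _ c c' (ORD _) (ORD _) fun A hA => ?_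
  -- One enumeration of the index subset orders both base sets compatibly.
  obtain ⟨e, he⟩ := A.exists_fin_enum hA
  rw [ORD_wellDefined _ _ _ (c ∘ e) (by simp [he]), ORD_wellDefined _ _ _ (c' ∘ e) (by simp [he])]
  refine (maxMetric_mk_le _ _ _ _).trans ?_
  have := relPair_cost_le hlam h (Finset.univ \ A) c c' (c ∘ e) (c' ∘ e) 0
    (fun i => by simpa using hc i) (fun j => by simpa using hc (e j))
  rw [Finset.map_sdiff, Finset.map_sdiff] at this
  convert this

theorem OCD_stable {n : ℕ} {lam : ℝ} (hlam : 0 < lam) (h : IsStrengthLipschitzConst (n + 1) lam)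
    {ι : Type*} [Fintype ι] (c c' : ι ↪ Pt (n + 1)) (w : Pt (n + 1))
    {ε : ℝ} (hc : ∀ i, dist (c i) (c' i + w) ≤ ε) (hw : ‖w‖ ≤ ε) (A : Finset ι)
    (hA : A.card = n) :
    maxMetric _ lam
        (OCD (Finset.univ.map c) (A.map c) ((Finset.card_map c).trans hA))
        (OCD (Finset.univ.map c') (A.map c') ((Finset.card_map c').trans hA)) ≤
      ENNReal.ofReal (2 * ε) := by
  classical
  obtain ⟨e, he⟩ := A.exists_fin_enum hA
  rw [OCD_wellDefined _ _ _ (c ∘ e) (by simp [he]), OCD_wellDefined _ _ _ (c' ∘ e) (by simp [he])]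
  refine (maxMetric_mk_le _ _ _ _).trans ?_
  have := relPair_cost_le hlam h (Finset.univ \ A) c c' (Fin.snoc (c ∘ e) 0)
    (Fin.snoc (c' ∘ e) 0) w hc (fun j => by
      refine Fin.lastCases ?_ (fun j => ?_) j
      · simpa using hw
      · simpa using hc (e j))
  rw [Finset.map_sdiff, Finset.map_sdiff] at this
  convert this

/-! ### Centring and the stability of SCD -/

theorem centred_map {n : ℕ} {ι : Type*} [Fintype ι] (c : ι ↪ Pt n) :
    centred (Finset.univ.map c) = Finset.univ.map (c.trans
      (Equiv.subRight ((Fintype.card ι : ℝ)⁻¹ • ∑ i, c i)).toEmbedding) := by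
  rw [centred, Finset.map_map, Finset.card_map, Finset.sum_map, Finset.card_univ]

theorem dist_centroid_le {E ι : Type*} [SeminormedAddCommGroup E] [NormedSpace ℝ E] [Fintype ι]
    [Nonempty ι] (c c' : ι → E) {ε : ℝ} (hc : ∀ i, dist (c i) (c' i) ≤ ε) :
    dist ((Fintype.card ι : ℝ)⁻¹ • ∑ i, c i) ((Fintype.card ι : ℝ)⁻¹ • ∑ i, c' i) ≤ ε := by
  have hpos : (0 : ℝ) < Fintype.card ι := by exact_mod_cast Fintype.card_pos
  rw [dist_eq_norm, ← smul_sub, ← Finset.sum_sub_distrib, norm_smul, norm_inv,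
    Real.norm_of_nonneg hpos.le, inv_mul_le_iff₀ hpos]
  refine (norm_sum_le_of_le _ fun i _ => (dist_eq_norm _ _).symm.trans_le (hc i)).trans_eq ?_
  simp

theorem SCD_stable {n : ℕ} {lam : ℝ} (hlam : 0 < lam) (h : IsStrengthLipschitzConst (n + 1) lam)
    {ι : Type*} [Fintype ι] [Nonempty ι] (hι : n ≤ Fintype.card ι) (c c' : ι ↪ Pt (n + 1)) {ε : ℝ}
    (hc : ∀ i, dist (c i) (c' i) ≤ ε) :
    linearAssignmentCost (maxMetric _ lam) (SCD (Finset.univ.map c)) (SCD (Finset.univ.map c')) ≤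
        ENNReal.ofReal (2 * ε) ∧
      earthMoverDist (maxMetric _ lam) (SCD (Finset.univ.map c)) (SCD (Finset.univ.map c')) ≤
        ENNReal.ofReal (2 * ε) := by
  set SCD' : Finset (Pt (n + 1)) → Multiset (OCDClass n) := fun B =>
    (B.powersetCard n).attach.val.map fun A => OCD B A.1 (Finset.mem_powersetCard.1 A.2).2
  change linearAssignmentCost _ (SCD' (centred _)) (SCD' (centred _)) ≤ _ ∧
    earthMoverDist _ (SCD' (centred _)) (SCD' (centred _)) ≤ _
  rw [centred_map, centred_map]
  refine linearAssignmentCost_and_earthMoverDist_le hι _ _ _ (OCD _) (OCD _) fun A hA => ?_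
  -- Adding this vector re-expresses the second cloud relative to the centre of the first, so each
  -- point is displaced as in the original clouds.
  refine OCD_stable hlam h _ _ ((Fintype.card ι : ℝ)⁻¹ • ∑ i, c' i -
    (Fintype.card ι : ℝ)⁻¹ • ∑ i, c i) (fun i => ?_) ?_ A hA
  · simpa using hc i
  · rw [← dist_eq_norm, dist_comm]
    exact dist_centroid_le c c' hc

theorem mainTheorem3 (n : ℕ) :
    -- Dimension `n + 1 ≥ 1`: the strength has a Lipschitz constant.
    (∃ lam : ℝ, 0 < lam ∧ IsStrengthLipschitzConst (n + 1) lam) ∧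
    -- The metrics normalised by any such constant change by at most `2 * ε`.
    ∀ lam : ℝ, 0 < lam → IsStrengthLipschitzConst (n + 1) lam →
      ∀ (ε : ℝ), 0 ≤ ε → ∀ (C C' : Finset (Pt (n + 1))) (g : C ≃ C'), C.Nonempty →
        (∀ p : C, dist (p : Pt (n + 1)) (g p : Pt (n + 1)) ≤ ε) →
        (n + 1 ≤ C.card →
          linearAssignmentCost (maxMetric ⊤ lam) (OSD C) (OSD C') ≤ ENNReal.ofReal (2 * ε) ∧
          earthMoverDist (maxMetric ⊤ lam) (OSD C) (OSD C') ≤ ENNReal.ofReal (2 * ε)) ∧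
        (n ≤ C.card →
          linearAssignmentCost (maxMetric _ lam) (SCD C) (SCD C') ≤ ENNReal.ofReal (2 * ε) ∧
          earthMoverDist (maxMetric _ lam) (SCD C) (SCD C') ≤ ENNReal.ofReal (2 * ε)) := by
  refine ⟨?_, fun lam hlam h ε _ C C' g hne hg => ?_⟩
  · obtain ⟨lam, hlam, h⟩ := exists_abs_strength_sub_le n
    exact ⟨lam, hlam, fun ε A A' _ _ => h ε A A'⟩
  -- Both clouds are indexed by `C`, the second through `g`.
  set c : C ↪ Pt (n + 1) := Function.Embedding.subtype (· ∈ C)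
  set c' : C ↪ Pt (n + 1) := g.toEmbedding.trans (Function.Embedding.subtype (· ∈ C'))
  have hC : Finset.univ.map c = C := Finset.attach_map_val
  have hC' : Finset.univ.map c' = C' := by
    rw [← Finset.map_map, Finset.map_univ_equiv]
    exact Finset.attach_map_val
  have : Nonempty C := hne.to_subtype
  refine ⟨fun hm => ?_, fun hm => ?_⟩
  · have := OSD_stable hlam h (by simpa using hm) c c' hg
    rwa [hC, hC'] at this
  · have := SCD_stable hlam h (by simpa using hm) c c' hg
    rwa [hC, hC'] at this
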